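/- Let $\mathbb{C}^\pm=\{z\in\mathbb{C}:\pm\operatorname{Im}z>0\}$ and let $H_\infty^\pm$ be the class of functions on $\mathbb{R}$ that are almost everywhere the boundary values of bounded analytic functions in $\mathbb{C}^\pm$. A bounded factorization of an $n\times n$ matrix function $G$ on $\mathbb{R}$ is a representation $G=G_-DG_+^{-1}$ (a.e. on $\mathbb{R}$) in which $G_+^{\pm1}\in (H_\infty^+)^{n\times n}$, $G_-^{\pm1}\in (H_\infty^-)^{n\times n}$, and $D=\operatorname{diag}[d_1,\dots,d_n]$ for some functions $d_j$ on $\mathbb{R}$, with no a priori condition on the $d_j$. It is canonical if $D=I$; in particular, a bounded canonical factorization of a scalar function $d$ is a representation $d=d_-d_+^{-1}$ with $d_\pm^{\pm1}\in H_\infty^\pm$, that is, with $d_+,d_+^{-1}\in H_\infty^+$ and $d_-,d_-^{-1}\in H_\infty^-$. Theorem. Let $G$ have a bounded canonical factorization $G=\widetilde G_-\widetilde G_+^{-1}$. (a) Let $G=G_-DG_+^{-1}$, $D=\operatorname{diag}[d_1,\dots,d_n]$, be any bounded factorization of $G$. Then each $d_j$ has a bounded canonical factorization. Moreover, for every choice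 of bounded canonical factorizations $d_j=d_{j-}d_{j+}^{-1}$, $j=1,\dots,n$, there is an invertible matrix $Z\in\mathbb{C}^{n\times n}$ such that $$G_\pm=\widetilde G_\pm Z D_\pm^{-1},\qquad D_\pm=\operatorname{diag}[d_{1\pm},\dots,d_{n\pm}],$$ almost everywhere on $\mathbb{R}$, with the same $Z$ for both signs. (b) Conversely, for every invertible $Z\in\mathbb{C}^{n\times n}$ and all functions $d_1,\dots,d_n$ with bounded canonical factorizations $d_j=d_{j-}d_{j+}^{-1}$, the functions $G_\pm=\widetilde G_\pm ZD_\pm^{-1}$, with $D_\pm=\operatorname{diag}[d_{1\pm},\dots,d_{n\pm}]$, give a bounded factorization $G=G_-DG_+^{-1}$ with $D=\operatorname{diag}[d_1,\dots,d_n]$. -/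

import Mathlib

open Filter Topology MeasureTheory

/-- The open half plane `{z : σ · Im z > 0}`: upper for `σ = 1`, lower for `σ = -1`. -/
def halfPlane (σ : ℤˣ) : Set ℂ := {z | 0 < ((σ : ℤ) : ℝ) * z.im}

/-- The Hardy class of bounded analytic functions in the upper (`σ = 1`) or lower (`σ = -1`)
half plane, viewed as functions on the real line: `f` is almost everywhere the boundary value
of a bounded analytic function `F`. By Fatou's theorem the vertical limits used here exist
almost everywhere for every such `F`, and agree with the nontangential ones. -/
def MemHInf (σ : ℤˣ) (f : ℝ → ℂ) : Prop :=
  ∃ F : ℂ → ℂ, DifferentiableOn ℂ F (halfPlane σ) ∧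
    (∃ C : ℝ, ∀ z ∈ halfPlane σ, ‖F z‖ ≤ C) ∧
    ∀ᵐ x : ℝ, Tendsto (fun y : ℝ => F ((x : ℂ) + ((σ : ℤ) : ℂ) * (y : ℂ) * Complex.I))
      (𝓝[>] (0 : ℝ)) (𝓝 (f x))

/-- `f` and its (almost everywhere defined) inverse lie in the Hardy class. -/
def InvertibleHInf (σ : ℤˣ) (f : ℝ → ℂ) : Prop :=
  (∀ᵐ x : ℝ, f x ≠ 0) ∧ MemHInf σ f ∧ MemHInf σ (fun x => (f x)⁻¹)

/-- The matrix function `A` and its (almost everywhere defined) inverse have all their entries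
in the Hardy class. -/
def MatInvertibleHInf {n : ℕ} (σ : ℤˣ) (A : ℝ → Matrix (Fin n) (Fin n) ℂ) : Prop :=
  (∀ᵐ x : ℝ, IsUnit (A x)) ∧
    (∀ i j, MemHInf σ (fun x => A x i j)) ∧
    (∀ i j, MemHInf σ (fun x => (A x)⁻¹ i j))

/-- `G = G₋ D G₊⁻¹` is a bounded factorization, where `D = diag (d₁, …, dₙ)`. -/
def IsBoundedFactorization {n : ℕ} (G Gm : ℝ → Matrix (Fin n) (Fin n) ℂ)
    (d : Fin n → ℝ → ℂ) (Gp : ℝ → Matrix (Fin n) (Fin n) ℂ) : Prop :=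
  MatInvertibleHInf (-1) Gm ∧ MatInvertibleHInf 1 Gp ∧
    ∀ᵐ x : ℝ, G x = Gm x * Matrix.diagonal (fun j => d j x) * (Gp x)⁻¹

/-- `G = G₋ G₊⁻¹` is a bounded canonical factorization: the middle factor is the identity. -/
def IsBoundedCanonicalFactorization {n : ℕ} (G Gm Gp : ℝ → Matrix (Fin n) (Fin n) ℂ) : Prop :=
  IsBoundedFactorization G Gm (fun _ _ => 1) Gp

/-- `d = d₋ d₊⁻¹` is a bounded canonical factorization of the scalar function `d`. -/
def IsScalarBoundedCanonicalFactorization (d dm dp : ℝ → ℂ) : Prop :=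
  InvertibleHInf (-1) dm ∧ InvertibleHInf 1 dp ∧ ∀ᵐ x : ℝ, d x = dm x * (dp x)⁻¹

/-! Everything rests on a Liouville principle: a function in both Hardy classes is almost everywhere
constant (`exists_ae_eq_const_of_memHInf`). Boundary values exist only almost everywhere, so the
glued function is replaced by its horizontal averages `∫ t in 0..h, F (z + t)`. These are continuous
across the real line, hence entire by Morera, and bounded, hence constant; their derivative `F (z +
h) - F z` then vanishes, so `F` is constant in the upper half plane.

For (a), put A± = G̃±⁻¹G±, so that A₋D = A₊. Comparing entries of this relation and of its inverse,
dⱼ cancels in (A₋)ᵢⱼ(A₋⁻¹)ⱼᵢ = (A₊)ᵢⱼ(A₊⁻¹)ⱼᵢ, which is therefore a constant cᵢ. Since ∑ᵢ cᵢ = 1,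
some cᵢ ≠ 0; the entries (A±)ᵢⱼ are then invertible in their classes, and their quotient is dⱼ.
Given any factors D±, A₋D₋ = A₊D₊ lies in both classes, so it is a constant matrix Z. Part (b) is
direct multiplication. -/

/-! ### Horizontal averages of bounded analytic functions. -/

lemma isOpen_halfPlane (σ : ℤˣ) : IsOpen (halfPlane σ) :=
  isOpen_lt continuous_const (continuous_const.mul Complex.continuous_im)

lemma convex_halfPlane (σ : ℤˣ) : Convex ℝ (halfPlane σ) :=
  convex_halfSpace_gt
    (IsLinearMap.mk (fun x y => by simp [mul_add]) (fun c x => by simp; ring)) 0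

lemma add_ofReal_mem_halfPlane {σ : ℤˣ} {z : ℂ} (hz : z ∈ halfPlane σ) (t : ℝ) :
    z + t ∈ halfPlane σ := by
  simpa [halfPlane] using hz

lemma intUnit_mul_self (σ : ℤˣ) : ((σ : ℤ) : ℝ) * ((σ : ℤ) : ℝ) = 1 := by
  rcases Int.units_eq_one_or σ with rfl | rfl <;> simp

lemma add_vertical_mem_halfPlane {σ : ℤˣ} {z : ℂ} (hz : 0 ≤ ((σ : ℤ) : ℝ) * z.im) {y : ℝ}
    (hy : 0 < y) : z + ((σ : ℤ) : ℂ) * (y : ℂ) * Complex.I ∈ halfPlane σ := by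
  have h := intUnit_mul_self σ
  simp only [halfPlane, Set.mem_ofPred_eq, Complex.add_im, Complex.mul_im, Complex.mul_re,
    Complex.I_re, Complex.I_im, Complex.ofReal_re, Complex.ofReal_im, Complex.intCast_re,
    Complex.intCast_im]
  nlinarith

/-- Differentiate under the integral, dominating by Cauchy's estimate, then integrate `deriv F`
along the horizontal segment. -/
lemma hasDerivAt_integral_translate {σ : ℤˣ} {F : ℂ → ℂ} (hF : DifferentiableOn ℂ F (halfPlane σ))
    {C : ℝ} (hC : ∀ z ∈ halfPlane σ, ‖F z‖ ≤ C) (h : ℝ) {z : ℂ} (hz : z ∈ halfPlane σ) :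
    HasDerivAt (fun w => ∫ t in (0 : ℝ)..h, F (w + t)) (F (z + h) - F z) z := by
  have hd : ∀ w ∈ halfPlane σ, HasDerivAt F (deriv F w) w := fun w hw =>
    (hF.differentiableAt ((isOpen_halfPlane σ).mem_nhds hw)).hasDerivAt
  have hmaps : ∀ w ∈ halfPlane σ, Continuous fun t : ℝ => F (w + t) := fun w hw =>
    hF.continuousOn.comp_continuous (by fun_prop) fun t => add_ofReal_mem_halfPlane hw t
  have hmaps' : Continuous fun t : ℝ => deriv F (z + t) :=
    (hF.deriv (isOpen_halfPlane σ)).continuousOn.comp_continuous (by fun_prop)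
      fun t => add_ofReal_mem_halfPlane hz t
  obtain ⟨r, hr, hball⟩ := Metric.isOpen_iff.1 (isOpen_halfPlane σ) z hz
  have hsub : ∀ t : ℝ, ∀ w ∈ Metric.ball z r, w + t ∈ halfPlane σ := fun t w hw =>
    add_ofReal_mem_halfPlane (hball hw) t
  -- Since `r / 2 + r / 4 < r` and the half plane is invariant under real shifts, Cauchy's estimate
  -- on discs of radius `r / 4` is uniform in `t`.
  have hbound : ∀ t : ℝ, ∀ w ∈ Metric.ball z (r / 2), ‖deriv F (w + t)‖ ≤ C / (r / 4) := by
    intro t w hw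
    have hcl : Metric.closedBall (w + t) (r / 4) ⊆ halfPlane σ := by
      intro u hu
      have h1 : u - t ∈ Metric.ball z r := by
        rw [Metric.mem_ball] at hw ⊢
        rw [Metric.mem_closedBall] at hu
        have h2 : dist (u - t) w = dist u (w + t) := by
          rw [dist_eq_norm, dist_eq_norm]; congr 1; ring
        have := dist_triangle (u - t) w z
        linarith
      simpa using hsub t _ h1
    refine Complex.norm_deriv_le_of_forall_mem_sphere_norm_le (by positivity) ?_ ?_
    · refine DifferentiableOn.diffContOnCl (hF.mono ?_)
      rwa [closure_ball _ (by positivity)]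
    · exact fun u hu => hC u (hcl (Metric.sphere_subset_closedBall hu))
  have key := intervalIntegral.hasDerivAt_integral_of_dominated_loc_of_deriv_le (μ := volume)
    (F := fun (w : ℂ) (t : ℝ) => F (w + t)) (F' := fun w t => deriv F (w + t)) (x₀ := z)
    (a := 0) (b := h) (bound := fun _ => C / (r / 4))
    (Metric.ball_mem_nhds z (half_pos hr))
    (by
      filter_upwards [(isOpen_halfPlane σ).mem_nhds hz] with w hw
      exact (hmaps w hw).aestronglyMeasurable)
    ((hmaps z hz).intervalIntegrable _ _)
    hmaps'.aestronglyMeasurable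
    (Eventually.of_forall fun t _ w hw => hbound t w hw)
    intervalIntegrable_const
    (Eventually.of_forall fun t _ w hw =>
      (hd (w + t) (hsub t w (Metric.ball_subset_ball (by linarith) hw))).comp_add_const w (t : ℂ))
  have hftc : ∫ t in (0 : ℝ)..h, deriv F (z + t) = F (z + h) - F z := by
    have := intervalIntegral.integral_eq_sub_of_hasDerivAt (a := 0) (b := h)
      (f := fun t : ℝ => F (z + t)) (f' := fun t : ℝ => deriv F (z + t))
      (fun t _ => by
        have h1 := (hd (z + t) (add_ofReal_mem_halfPlane hz t)).comp_const_add z (t : ℂ)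
        exact h1.comp_ofReal)
      (hmaps'.intervalIntegrable _ _)
    simpa using this
  rw [← hftc]
  exact key.2

/-- Translation averages of a bounded analytic function converge vertically, on the closed half
plane, to the translation averages of its boundary function. -/
lemma tendsto_integral_translate {σ : ℤˣ} {F : ℂ → ℂ} (hF : DifferentiableOn ℂ F (halfPlane σ))
    {C : ℝ} (hC : ∀ z ∈ halfPlane σ, ‖F z‖ ≤ C)
    (hb : ∀ᵐ x : ℝ, Tendsto (fun y : ℝ => F ((x : ℂ) + ((σ : ℤ) : ℂ) * (y : ℂ) * Complex.I))
      (𝓝[>] (0 : ℝ)) (𝓝 (F x))) (h : ℝ) {z : ℂ} (hz : 0 ≤ ((σ : ℤ) : ℝ) * z.im) :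
    Tendsto (fun y : ℝ => ∫ t in (0 : ℝ)..h, F (z + ((σ : ℤ) : ℂ) * (y : ℂ) * Complex.I + t))
      (𝓝[>] (0 : ℝ)) (𝓝 (∫ t in (0 : ℝ)..h, F (z + t))) := by
  have hlim : ∀ᵐ t : ℝ, Tendsto
      (fun y : ℝ => F (z + ((σ : ℤ) : ℂ) * (y : ℂ) * Complex.I + t)) (𝓝[>] (0 : ℝ))
      (𝓝 (F (z + t))) := by
    -- Inside the half plane this is continuity of `F`; on the real line it is `hb`, shifted by
    -- `z.re`, which preserves null sets.
    rcases hz.lt_or_eq with hz | hz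
    · refine Eventually.of_forall fun t => ?_
      have h1 : ContinuousAt F (z + t) := (hF.differentiableAt
        ((isOpen_halfPlane σ).mem_nhds (add_ofReal_mem_halfPlane hz t))).continuousAt
      refine h1.tendsto.comp (tendsto_nhdsWithin_of_tendsto_nhds ?_)
      have h2 : Continuous fun y : ℝ => z + ((σ : ℤ) : ℂ) * (y : ℂ) * Complex.I + t := by fun_prop
      simpa using h2.tendsto 0
    · have him : z.im = 0 := by
        have := intUnit_mul_self σ
        rcases mul_eq_zero.1 hz.symm with h0 | h0
        · simp [h0] at this
        · exact h0
      have hzr : z = (z.re : ℂ) := by apply Complex.ext <;> simp [him]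
      filter_upwards [(measurePreserving_add_left (volume : Measure ℝ)
        z.re).quasiMeasurePreserving.ae hb] with t ht
      rw [hzr]
      push_cast at ht
      refine ht.congr fun y => ?_
      congr 1
      ring
  refine intervalIntegral.tendsto_integral_filter_of_dominated_convergence (fun _ => C) ?_ ?_
    intervalIntegrable_const (hlim.mono fun t ht _ => ht)
  · filter_upwards [self_mem_nhdsWithin] with y hy
    exact (hF.continuousOn.comp_continuous (by fun_prop) fun t =>
      add_ofReal_mem_halfPlane (add_vertical_mem_halfPlane hz hy) t).aestronglyMeasurable
  · filter_upwards [self_mem_nhdsWithin] with y hy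
    exact Eventually.of_forall fun t _ =>
      hC _ (add_ofReal_mem_halfPlane (add_vertical_mem_halfPlane hz hy) t)

lemma norm_integral_translate_le {σ : ℤˣ} {F : ℂ → ℂ} (hF : DifferentiableOn ℂ F (halfPlane σ))
    {C : ℝ} (hC : ∀ z ∈ halfPlane σ, ‖F z‖ ≤ C)
    (hb : ∀ᵐ x : ℝ, Tendsto (fun y : ℝ => F ((x : ℂ) + ((σ : ℤ) : ℂ) * (y : ℂ) * Complex.I))
      (𝓝[>] (0 : ℝ)) (𝓝 (F x))) (h : ℝ) {z : ℂ} (hz : 0 ≤ ((σ : ℤ) : ℝ) * z.im) :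
    ‖∫ t in (0 : ℝ)..h, F (z + t)‖ ≤ C * |h| := by
  refine le_of_tendsto (tendsto_integral_translate hF hC hb h hz).norm ?_
  filter_upwards [self_mem_nhdsWithin] with y hy
  simpa using intervalIntegral.norm_integral_le_of_norm_le_const (a := 0) (b := h)
    (f := fun t : ℝ => F (z + ((σ : ℤ) : ℂ) * (y : ℂ) * Complex.I + t)) (C := C)
    fun t _ => hC _ (add_ofReal_mem_halfPlane (add_vertical_mem_halfPlane hz hy) t)

/-- The derivative `F (z + h) - F z` is bounded by `2C`, so the average is Lipschitz on the convex
open half plane; vertical limits carry the estimate to the closure. -/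
lemma continuousOn_integral_translate {σ : ℤˣ} {F : ℂ → ℂ}
    (hF : DifferentiableOn ℂ F (halfPlane σ)) {C : ℝ} (hC : ∀ z ∈ halfPlane σ, ‖F z‖ ≤ C)
    (hb : ∀ᵐ x : ℝ, Tendsto (fun y : ℝ => F ((x : ℂ) + ((σ : ℤ) : ℂ) * (y : ℂ) * Complex.I))
      (𝓝[>] (0 : ℝ)) (𝓝 (F x))) (h : ℝ) :
    ContinuousOn (fun z : ℂ => ∫ t in (0 : ℝ)..h, F (z + t)) {z | 0 ≤ ((σ : ℤ) : ℝ) * z.im} := by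
  have hlip : ∀ z ∈ halfPlane σ, ∀ w ∈ halfPlane σ,
      ‖(∫ t in (0 : ℝ)..h, F (w + t)) - ∫ t in (0 : ℝ)..h, F (z + t)‖ ≤ (C + C) * ‖w - z‖ := by
    intro z hz w hw
    refine (convex_halfPlane σ).norm_image_sub_le_of_norm_hasDerivWithin_le
      (f := fun z : ℂ => ∫ t in (0 : ℝ)..h, F (z + t)) (f' := fun z => F (z + h) - F z)
      (fun u hu => (hasDerivAt_integral_translate hF hC h hu).hasDerivWithinAt)
      (fun u hu => ?_) hz hw
    exact (norm_sub_le _ _).trans (add_le_add (hC _ (add_ofReal_mem_halfPlane hu h)) (hC u hu))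
  have hlip' : ∀ z ∈ {z : ℂ | 0 ≤ ((σ : ℤ) : ℝ) * z.im}, ∀ w ∈ {z : ℂ | 0 ≤ ((σ : ℤ) : ℝ) * z.im},
      ‖(∫ t in (0 : ℝ)..h, F (w + t)) - ∫ t in (0 : ℝ)..h, F (z + t)‖ ≤ (C + C) * ‖w - z‖ := by
    intro z hz w hw
    refine le_of_tendsto ((tendsto_integral_translate hF hC hb h hw).sub
      (tendsto_integral_translate hF hC hb h hz)).norm ?_
    filter_upwards [self_mem_nhdsWithin] with y hy
    simpa using hlip _ (add_vertical_mem_halfPlane hz hy) _ (add_vertical_mem_halfPlane hw hy)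
  exact (LipschitzOnWith.of_dist_le_mul (K := (C + C).toNNReal) fun z hz w hw => by
    rw [dist_eq_norm, dist_eq_norm]
    exact (hlip' w hw z hz).trans
      (mul_le_mul_of_nonneg_right (Real.le_coe_toNNReal _) (norm_nonneg _))).continuousOn

/-! ### Liouville principle across the real line. -/

/-- A continuous function on the plane that is analytic off the real line is entire. -/
lemma differentiable_of_differentiableAt_off_real {Φ : ℂ → ℂ} (hc : Continuous Φ)
    (hd : ∀ z : ℂ, z.im ≠ 0 → DifferentiableAt ℂ Φ z) : Differentiable ℂ Φ := by
  -- A rectangle with a side on the real axis has its interior off the axis, so Cauchy's theorem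
  -- needs only continuity on its boundary.
  have hrect : ∀ z w : ℂ, (z.im = 0 ∨ w.im = 0) →
      (∫ x : ℝ in z.re..w.re, Φ (x + z.im * Complex.I)) -
        (∫ x : ℝ in z.re..w.re, Φ (x + w.im * Complex.I)) +
        Complex.I • (∫ y : ℝ in z.im..w.im, Φ (w.re + y * Complex.I)) -
        Complex.I • (∫ y : ℝ in z.im..w.im, Φ (z.re + y * Complex.I)) = 0 := by
    intro z w hzw
    refine Complex.integral_boundary_rect_eq_zero_of_continuousOn_of_differentiableOn Φ z w
      hc.continuousOn fun u hu => (hd u fun h0 => ?_).differentiableWithinAt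
    have h1 := hu.2
    simp only [Set.mem_preimage, h0, Set.mem_Ioo, min_lt_iff, lt_max_iff] at h1
    rcases hzw with h | h <;> rw [h] at h1 <;> rcases h1 with ⟨h1 | h1, h2 | h2⟩ <;> linarith
  have hcons : Complex.IsConservativeOn Φ Set.univ := by
    intro z w _
    rw [← add_eq_zero_iff_eq_neg, Complex.wedgeIntegral_add_wedgeIntegral_eq]
    -- Cut at the real axis: the two integrals along it cancel, and signed integrals also cover
    -- rectangles that miss the axis.
    have h1 := hrect z w.re (Or.inr (by simp))
    have h2 := hrect z.re w (Or.inl (by simp))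
    simp only [Complex.ofReal_re, Complex.ofReal_im] at h1 h2
    have hv : ∀ a : ℝ, (∫ y : ℝ in z.im..w.im, Φ (a + y * Complex.I)) =
        (∫ y : ℝ in z.im..0, Φ (a + y * Complex.I)) +
          ∫ y : ℝ in (0 : ℝ)..w.im, Φ (a + y * Complex.I) := fun a => by
      have hca : Continuous fun y : ℝ => Φ (a + y * Complex.I) := by fun_prop
      exact (intervalIntegral.integral_add_adjacent_intervals (hca.intervalIntegrable _ _)
        (hca.intervalIntegrable _ _)).symm
    rw [hv, hv, smul_add, smul_add]
    linear_combination h1 + h2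
  exact differentiableOn_univ.1 ((hcons.isExactOn_univ hc).differentiableOn isOpen_univ)

/-- The intersection of the two Hardy classes consists of the constants. -/
theorem exists_ae_eq_const_of_memHInf {f : ℝ → ℂ} (hp : MemHInf 1 f) (hm : MemHInf (-1) f) :
    ∃ c : ℂ, ∀ᵐ x, f x = c := by
  obtain ⟨P, hPd, ⟨C, hPC⟩, hPb⟩ := hp
  obtain ⟨M, hMd, ⟨C', hMC⟩, hMb⟩ := hm
  -- With the value `f` on the real line, the averages from above and from below share the same
  -- boundary values.
  set F : ℂ → ℂ := fun z => if 0 < z.im then P z else if z.im < 0 then M z else f z.re with hFdef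
  have hFP : ∀ z ∈ halfPlane 1, F z = P z := fun z hz => by
    have : 0 < z.im := by simpa [halfPlane] using hz
    simp [hFdef, this]
  have hFM : ∀ z ∈ halfPlane (-1), F z = M z := fun z hz => by
    have : z.im < 0 := by simpa [halfPlane] using hz
    simp [hFdef, this, not_lt.2 this.le]
  have hFr : ∀ x : ℝ, F x = f x := fun x => by simp [hFdef]
  have dP : DifferentiableOn ℂ F (halfPlane 1) := hPd.congr hFP
  have dM : DifferentiableOn ℂ F (halfPlane (-1)) := hMd.congr hFM
  have cP : ∀ z ∈ halfPlane 1, ‖F z‖ ≤ C := fun z hz => by rw [hFP z hz]; exact hPC z hz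
  have cM : ∀ z ∈ halfPlane (-1), ‖F z‖ ≤ C' := fun z hz => by rw [hFM z hz]; exact hMC z hz
  have bP : ∀ᵐ x : ℝ, Tendsto
      (fun y : ℝ => F ((x : ℂ) + (((1 : ℤˣ) : ℤ) : ℂ) * (y : ℂ) * Complex.I))
      (𝓝[>] (0 : ℝ)) (𝓝 (F x)) := by
    filter_upwards [hPb] with x hx
    rw [hFr]
    refine hx.congr' ?_
    filter_upwards [self_mem_nhdsWithin] with y hy
    exact (hFP _ (add_vertical_mem_halfPlane (by simp) hy)).symm
  have bM : ∀ᵐ x : ℝ, Tendsto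
      (fun y : ℝ => F ((x : ℂ) + (((-1 : ℤˣ) : ℤ) : ℂ) * (y : ℂ) * Complex.I))
      (𝓝[>] (0 : ℝ)) (𝓝 (F x)) := by
    filter_upwards [hMb] with x hx
    rw [hFr]
    refine hx.congr' ?_
    filter_upwards [self_mem_nhdsWithin] with y hy
    exact (hFM _ (add_vertical_mem_halfPlane (by simp) hy)).symm
  have hper : ∀ h : ℝ, ∀ z ∈ halfPlane 1, F (z + h) = F z := by
    intro h z hz
    have hcont : Continuous fun z : ℂ => ∫ t in (0 : ℝ)..h, F (z + t) := by
      rw [← continuousOn_univ]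
      have hcover : (Set.univ : Set ℂ) = {z | 0 ≤ (((1 : ℤˣ) : ℤ) : ℝ) * z.im} ∪
          {z | 0 ≤ (((-1 : ℤˣ) : ℤ) : ℝ) * z.im} := by
        ext z
        simpa using le_total 0 z.im
      rw [hcover]
      exact (continuousOn_integral_translate dP cP bP h).union_of_isClosed
        (continuousOn_integral_translate dM cM bM h)
        (isClosed_le continuous_const (continuous_const.mul Complex.continuous_im))
        (isClosed_le continuous_const (continuous_const.mul Complex.continuous_im))
    have hdiff : Differentiable ℂ fun z : ℂ => ∫ t in (0 : ℝ)..h, F (z + t) := by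
      refine differentiable_of_differentiableAt_off_real hcont fun z hz => ?_
      rcases hz.lt_or_gt with hz | hz
      · exact (hasDerivAt_integral_translate dM cM h
          (by simpa [halfPlane] using hz)).differentiableAt
      · exact (hasDerivAt_integral_translate dP cP h
          (by simpa [halfPlane] using hz)).differentiableAt
    have hbdd : Bornology.IsBounded (Set.range fun z : ℂ => ∫ t in (0 : ℝ)..h, F (z + t)) := by
      refine isBounded_iff_forall_norm_le.2 ⟨max (C * |h|) (C' * |h|), ?_⟩
      rintro _ ⟨z, rfl⟩
      rcases le_total 0 z.im with hz | hz
      · exact (norm_integral_translate_le dP cP bP h (by simpa using hz)).trans (le_max_left _ _)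
      · exact (norm_integral_translate_le dM cM bM h (by simpa using hz)).trans (le_max_right _ _)
    obtain ⟨c, hc⟩ := hdiff.exists_const_forall_eq_of_bounded hbdd
    have h1 := hasDerivAt_integral_translate dP cP h hz
    rw [funext hc] at h1
    exact sub_eq_zero.1 (h1.unique (hasDerivAt_const z c))
  -- The complex derivative equals the derivative in the real direction, where `F` is constant by
  -- `hper`.
  have hderiv : (halfPlane 1).EqOn (deriv F) 0 := by
    intro z hz
    have h1 := (dP.differentiableAt ((isOpen_halfPlane 1).mem_nhds hz)).hasDerivAt
    have h2 : HasDerivAt (fun t : ℝ => F (z + t)) (deriv F z) 0 := by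
      have h3 : HasDerivAt F (deriv F z) (z + (0 : ℝ)) := by simpa using h1
      exact (h3.comp_const_add z ((0 : ℝ) : ℂ)).comp_ofReal
    rw [funext fun t => hper t z hz] at h2
    exact h2.unique (hasDerivAt_const _ _)
  have hI : Complex.I ∈ halfPlane 1 := by simp [halfPlane]
  refine ⟨F Complex.I, ?_⟩
  filter_upwards [bP] with x hx
  rw [← hFr]
  refine tendsto_nhds_unique hx (tendsto_const_nhds.congr' ?_)
  filter_upwards [self_mem_nhdsWithin] with y hy
  exact (isOpen_halfPlane 1).is_const_of_deriv_eq_zero (convex_halfPlane 1).isPreconnected dP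
    hderiv hI (add_vertical_mem_halfPlane (by simp) hy)

/-! ### Algebra of the Hardy classes and their invertible matrices. -/

lemma MemHInf.congr {σ : ℤˣ} {f g : ℝ → ℂ} (hf : MemHInf σ f) (h : ∀ᵐ x, f x = g x) :
    MemHInf σ g := by
  obtain ⟨F, hd, hC, hb⟩ := hf
  refine ⟨F, hd, hC, ?_⟩
  filter_upwards [hb, h] with x hx hfg
  rwa [← hfg]

lemma memHInf_const (σ : ℤˣ) (c : ℂ) : MemHInf σ fun _ => c :=
  ⟨fun _ => c, differentiableOn_const c, ⟨‖c‖, fun _ _ => le_rfl⟩,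
    Eventually.of_forall fun _ => tendsto_const_nhds⟩

lemma MemHInf.add {σ : ℤˣ} {f g : ℝ → ℂ} (hf : MemHInf σ f) (hg : MemHInf σ g) :
    MemHInf σ fun x => f x + g x := by
  obtain ⟨F, hFd, ⟨C, hFC⟩, hFb⟩ := hf
  obtain ⟨K, hKd, ⟨C', hKC⟩, hKb⟩ := hg
  refine ⟨fun z => F z + K z, hFd.add hKd, ⟨C + C', fun z hz =>
    (norm_add_le _ _).trans (add_le_add (hFC z hz) (hKC z hz))⟩, ?_⟩
  filter_upwards [hFb, hKb] with x hx hx'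
  exact hx.add hx'

lemma MemHInf.mul {σ : ℤˣ} {f g : ℝ → ℂ} (hf : MemHInf σ f) (hg : MemHInf σ g) :
    MemHInf σ fun x => f x * g x := by
  obtain ⟨F, hFd, ⟨C, hFC⟩, hFb⟩ := hf
  obtain ⟨K, hKd, ⟨C', hKC⟩, hKb⟩ := hg
  refine ⟨fun z => F z * K z, hFd.mul hKd, ⟨C * C', fun z hz => ?_⟩, ?_⟩
  · rw [norm_mul]
    exact mul_le_mul (hFC z hz) (hKC z hz) (norm_nonneg _) ((norm_nonneg _).trans (hFC z hz))
  · filter_upwards [hFb, hKb] with x hx hx'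
    exact hx.mul hx'

lemma MemHInf.sum {σ : ℤˣ} {ι : Type*} (s : Finset ι) {f : ι → ℝ → ℂ}
    (hf : ∀ i ∈ s, MemHInf σ (f i)) : MemHInf σ fun x => ∑ i ∈ s, f i x := by
  classical
  induction s using Finset.induction_on with
  | empty => simpa using memHInf_const σ 0
  | insert a s ha ih =>
    simp only [Finset.sum_insert ha]
    exact (hf a (Finset.mem_insert_self a s)).add
      (ih fun i hi => hf i (Finset.mem_insert_of_mem hi))

lemma memHInf_matrix_mul {n : ℕ} {σ : ℤˣ} {A B : ℝ → Matrix (Fin n) (Fin n) ℂ}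
    (hA : ∀ i j, MemHInf σ fun x => A x i j) (hB : ∀ i j, MemHInf σ fun x => B x i j)
    (i j : Fin n) : MemHInf σ fun x => (A x * B x) i j := by
  simp only [Matrix.mul_apply]
  exact MemHInf.sum _ fun k _ => (hA i k).mul (hB k j)

lemma Matrix.inv_inv_of_isUnit {n : ℕ} {A : Matrix (Fin n) (Fin n) ℂ} (hA : IsUnit A) :
    A⁻¹⁻¹ = A :=
  Matrix.nonsing_inv_nonsing_inv A ((Matrix.isUnit_iff_isUnit_det A).1 hA)

lemma Matrix.mul_inv_of_isUnit {n : ℕ} {A : Matrix (Fin n) (Fin n) ℂ} (hA : IsUnit A) :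
    A * A⁻¹ = 1 :=
  Matrix.mul_nonsing_inv A ((Matrix.isUnit_iff_isUnit_det A).1 hA)

lemma Matrix.inv_mul_of_isUnit {n : ℕ} {A : Matrix (Fin n) (Fin n) ℂ} (hA : IsUnit A) :
    A⁻¹ * A = 1 :=
  Matrix.nonsing_inv_mul A ((Matrix.isUnit_iff_isUnit_det A).1 hA)

lemma MatInvertibleHInf.inv {n : ℕ} {σ : ℤˣ} {A : ℝ → Matrix (Fin n) (Fin n) ℂ}
    (hA : MatInvertibleHInf σ A) : MatInvertibleHInf σ fun x => (A x)⁻¹ := by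
  refine ⟨hA.1.mono fun x hx => Matrix.isUnit_nonsing_inv_iff.2 hx, hA.2.2, fun i j =>
    (hA.2.1 i j).congr (hA.1.mono fun x hx => ?_)⟩
  simp only [Matrix.inv_inv_of_isUnit hx]

lemma MatInvertibleHInf.mul {n : ℕ} {σ : ℤˣ} {A B : ℝ → Matrix (Fin n) (Fin n) ℂ}
    (hA : MatInvertibleHInf σ A) (hB : MatInvertibleHInf σ B) :
    MatInvertibleHInf σ fun x => A x * B x := by
  refine ⟨?_, memHInf_matrix_mul hA.2.1 hB.2.1, ?_⟩
  · filter_upwards [hA.1, hB.1] with x hx hx'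
    exact hx.mul hx'
  · simp only [Matrix.mul_inv_rev]
    exact memHInf_matrix_mul hB.2.2 hA.2.2

lemma matInvertibleHInf_const {n : ℕ} (σ : ℤˣ) {Z : Matrix (Fin n) (Fin n) ℂ} (hZ : IsUnit Z) :
    MatInvertibleHInf σ fun _ => Z :=
  ⟨Eventually.of_forall fun _ => hZ, fun _ _ => memHInf_const _ _, fun _ _ => memHInf_const _ _⟩

lemma InvertibleHInf.inv {σ : ℤˣ} {f : ℝ → ℂ} (hf : InvertibleHInf σ f) :
    InvertibleHInf σ fun x => (f x)⁻¹ :=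
  ⟨hf.1.mono fun _ hx => inv_ne_zero hx, hf.2.2, by simpa using hf.2.1⟩

lemma invertibleHInf_of_mul_eq_const {σ : ℤˣ} {f g : ℝ → ℂ} {c : ℂ} (hf : MemHInf σ f)
    (hg : MemHInf σ g) (hc : c ≠ 0) (h : ∀ᵐ x, f x * g x = c) : InvertibleHInf σ f := by
  have hne : ∀ᵐ x, f x ≠ 0 := h.mono fun x hx h0 => hc (by rw [← hx, h0, zero_mul])
  refine ⟨hne, hf, ((memHInf_const σ c⁻¹).mul hg).congr ?_⟩
  filter_upwards [h, hne] with x hx h0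
  rw [← hx]
  have hg0 : g x ≠ 0 := fun h1 => hc (by rw [← hx, h1, mul_zero])
  field_simp

lemma Matrix.diagonal_inv_of_ne_zero {n : ℕ} {v : Fin n → ℂ} (hv : ∀ j, v j ≠ 0) :
    (Matrix.diagonal v)⁻¹ = Matrix.diagonal fun j => (v j)⁻¹ := by
  refine Matrix.inv_eq_right_inv ?_
  rw [Matrix.diagonal_mul_diagonal]
  simp [hv]

lemma Matrix.isUnit_diagonal_of_ne_zero {n : ℕ} {v : Fin n → ℂ} (hv : ∀ j, v j ≠ 0) :
    IsUnit (Matrix.diagonal v) := by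
  rw [Matrix.isUnit_iff_isUnit_det, Matrix.det_diagonal]
  exact (Finset.prod_ne_zero_iff.2 fun j _ => hv j).isUnit

lemma matInvertibleHInf_diagonal {n : ℕ} {σ : ℤˣ} {f : Fin n → ℝ → ℂ}
    (hf : ∀ j, InvertibleHInf σ (f j)) :
    MatInvertibleHInf σ fun x => Matrix.diagonal fun j => f j x := by
  have hne : ∀ᵐ x, ∀ j, f j x ≠ 0 := ae_all_iff.2 fun j => (hf j).1
  have hmem : ∀ g : Fin n → ℝ → ℂ, (∀ j, MemHInf σ (g j)) →
      ∀ i j, MemHInf σ fun x => Matrix.diagonal (fun j => g j x) i j := fun g hg i j => by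
    by_cases hij : i = j
    · subst hij
      simpa using hg i
    · simpa [hij] using memHInf_const σ 0
  refine ⟨hne.mono fun x hx => Matrix.isUnit_diagonal_of_ne_zero hx,
    hmem f fun j => (hf j).2.1, fun i j =>
      (hmem (fun j x => (f j x)⁻¹) (fun j => (hf j).2.2) i j).congr (hne.mono fun x hx => ?_)⟩
  rw [Matrix.diagonal_inv_of_ne_zero hx]

/-! ### Diagonal middle factors and the main theorem. -/

/-- If `A₋ D = A₊` with `D` diagonal and `A₊`, `A₋` invertible over the two Hardy classes, then the
diagonal entries have bounded canonical factorizations. -/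
lemma exists_isScalarBoundedCanonicalFactorization {n : ℕ} {d : Fin n → ℝ → ℂ}
    {Am Ap : ℝ → Matrix (Fin n) (Fin n) ℂ} (hm : MatInvertibleHInf (-1) Am)
    (hp : MatInvertibleHInf 1 Ap)
    (h : ∀ᵐ x, Am x * Matrix.diagonal (fun j => d j x) = Ap x) (j : Fin n) :
    ∃ dm dp : ℝ → ℂ, IsScalarBoundedCanonicalFactorization (d j) dm dp := by
  have hentry : ∀ᵐ x, ∀ i, Am x i j * d j x = Ap x i j := by
    filter_upwards [h] with x hx i
    rw [← hx, Matrix.mul_diagonal]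
  have hinv : ∀ᵐ x, ∀ i, (Am x)⁻¹ j i = d j x * (Ap x)⁻¹ j i := by
    filter_upwards [h, hm.1, hp.1] with x hx hmx hpx i
    rw [← Matrix.diagonal_mul (fun j => d j x)]
    refine congrFun (congrFun ?_ j) i
    calc (Am x)⁻¹ = (Am x)⁻¹ * (Ap x * (Ap x)⁻¹) := by
          rw [Matrix.mul_inv_of_isUnit hpx, mul_one]
      _ = ((Am x)⁻¹ * Am x) * Matrix.diagonal (fun j => d j x) * (Ap x)⁻¹ := by
          nth_rewrite 1 [← hx]
          simp only [mul_assoc]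
      _ = _ := by rw [Matrix.inv_mul_of_isUnit hmx, one_mul]
  have heq : ∀ i, ∀ᵐ x, Am x i j * (Am x)⁻¹ j i = Ap x i j * (Ap x)⁻¹ j i := fun i => by
    filter_upwards [hentry, hinv] with x h1 h2
    rw [h2, ← h1]
    ring
  have hconst : ∀ i, ∃ c : ℂ, ∀ᵐ x, Ap x i j * (Ap x)⁻¹ j i = c := fun i =>
    exists_ae_eq_const_of_memHInf ((hp.2.1 i j).mul (hp.2.2 j i))
      (((hm.2.1 i j).mul (hm.2.2 j i)).congr (heq i))
  choose c hc using hconst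
  -- The sum is the `(j, j)` entry of `(Ap x)⁻¹ * Ap x`.
  have hsum : ∑ i, c i = 1 := by
    have hae : ∀ᵐ _ : ℝ, ∑ i, c i = 1 := by
      filter_upwards [ae_all_iff.2 hc, hp.1] with x hx hpx
      have h1 := congrFun (congrFun (Matrix.inv_mul_of_isUnit hpx) j) j
      rw [Matrix.mul_apply, Matrix.one_apply_eq] at h1
      rw [← h1]
      exact Finset.sum_congr rfl fun i _ => by rw [← hx i, mul_comm]
    exact hae.exists.choose_spec
  obtain ⟨i, -, hi⟩ := Finset.exists_ne_zero_of_sum_ne_zero (hsum.trans_ne one_ne_zero)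
  have hmi : InvertibleHInf (-1) fun x => Am x i j :=
    invertibleHInf_of_mul_eq_const (hm.2.1 i j) (hm.2.2 j i) hi
      (by filter_upwards [heq i, hc i] with x h1 h2; rw [h1, h2])
  have hpi : InvertibleHInf 1 fun x => Ap x i j :=
    invertibleHInf_of_mul_eq_const (hp.2.1 i j) (hp.2.2 j i) hi (hc i)
  -- The factors are the reciprocals of the entries, because `d j x` is `Ap x i j` divided by `Am x
  -- i j`.
  refine ⟨_, _, hmi.inv, hpi.inv, ?_⟩
  filter_upwards [hentry, hmi.1] with x h1 h2
  rw [inv_inv, ← h1 i, inv_mul_cancel_left₀ h2]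

/-- Liouville applies entrywise; the constant matrix is invertible because it equals `Ap x` at some
point where `Ap x` is a unit. -/
lemma exists_isUnit_ae_eq_const {n : ℕ} {Am Ap : ℝ → Matrix (Fin n) (Fin n) ℂ}
    (hm : MatInvertibleHInf (-1) Am) (hp : MatInvertibleHInf 1 Ap) (h : ∀ᵐ x, Am x = Ap x) :
    ∃ Z : Matrix (Fin n) (Fin n) ℂ, IsUnit Z ∧ (∀ᵐ x, Am x = Z) ∧ ∀ᵐ x, Ap x = Z := by
  have hconst : ∀ i j, ∃ c : ℂ, ∀ᵐ x, Ap x i j = c := fun i j =>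
    exists_ae_eq_const_of_memHInf (hp.2.1 i j)
      ((hm.2.1 i j).congr (h.mono fun x hx => by rw [hx]))
  choose c hc using hconst
  have hZ : ∀ᵐ x, Ap x = Matrix.of c := by
    filter_upwards [ae_all_iff.2 fun i => ae_all_iff.2 (hc i)] with x hx
    ext i j
    exact hx i j
  refine ⟨Matrix.of c, ?_, ?_, hZ⟩
  · obtain ⟨x, hx, hx'⟩ := (hZ.and hp.1).exists
    rwa [← hx]
  · filter_upwards [h, hZ] with x h1 h2
    rw [h1, h2]

theorem mainTheorem11 (n : ℕ) (G tGm tGp : ℝ → Matrix (Fin n) (Fin n) ℂ)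
    (hG : IsBoundedCanonicalFactorization G tGm tGp) :
    (∀ (Gm : ℝ → Matrix (Fin n) (Fin n) ℂ) (d : Fin n → ℝ → ℂ)
        (Gp : ℝ → Matrix (Fin n) (Fin n) ℂ), IsBoundedFactorization G Gm d Gp →
      (∀ j, ∃ dm dp : ℝ → ℂ, IsScalarBoundedCanonicalFactorization (d j) dm dp) ∧
      ∀ dm dp : Fin n → ℝ → ℂ,
        (∀ j, IsScalarBoundedCanonicalFactorization (d j) (dm j) (dp j)) →
        ∃ Z : Matrix (Fin n) (Fin n) ℂ, IsUnit Z ∧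
          (∀ᵐ x : ℝ, Gm x = tGm x * Z * (Matrix.diagonal (fun j => dm j x))⁻¹) ∧
          (∀ᵐ x : ℝ, Gp x = tGp x * Z * (Matrix.diagonal (fun j => dp j x))⁻¹)) ∧
    (∀ (d dm dp : Fin n → ℝ → ℂ) (Z : Matrix (Fin n) (Fin n) ℂ), IsUnit Z →
      (∀ j, IsScalarBoundedCanonicalFactorization (d j) (dm j) (dp j)) →
      IsBoundedFactorization G
        (fun x => tGm x * Z * (Matrix.diagonal (fun j => dm j x))⁻¹) d
        (fun x => tGp x * Z * (Matrix.diagonal (fun j => dp j x))⁻¹)) := by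
  obtain ⟨htm, htp, hGt⟩ := hG
  simp only [Matrix.diagonal_one, mul_one] at hGt
  have hdiag : ∀ d dm dp : Fin n → ℝ → ℂ,
      (∀ j, IsScalarBoundedCanonicalFactorization (d j) (dm j) (dp j)) →
      ∀ᵐ x, Matrix.diagonal (fun j => d j x) * Matrix.diagonal (fun j => dp j x) =
        Matrix.diagonal (fun j => dm j x) := fun d dm dp hd => by
    filter_upwards [ae_all_iff.2 fun j => (hd j).2.2, ae_all_iff.2 fun j => (hd j).2.1.1]
      with x h1 h2
    rw [Matrix.diagonal_mul_diagonal]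
    congr 1
    funext j
    rw [h1 j, inv_mul_cancel_right₀ (h2 j)]
  refine ⟨fun Gm d Gp ⟨hm, hp, hGf⟩ => ?_, fun d dm dp Z hZ hd => ?_⟩
  · have hAm := htm.inv.mul hm
    have hAp := htp.inv.mul hp
    have hA : ∀ᵐ x, (tGm x)⁻¹ * Gm x * Matrix.diagonal (fun j => d j x) =
        (tGp x)⁻¹ * Gp x := by
      filter_upwards [hGt, hGf, htm.1, hp.1] with x h1 h2 h3 h4
      calc (tGm x)⁻¹ * Gm x * Matrix.diagonal (fun j => d j x)
          = (tGm x)⁻¹ * (Gm x * Matrix.diagonal (fun j => d j x) * (Gp x)⁻¹) * Gp x := by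
            simp only [mul_assoc, Matrix.inv_mul_of_isUnit h4, mul_one]
        _ = ((tGm x)⁻¹ * tGm x) * (tGp x)⁻¹ * Gp x := by
            rw [← h2, h1]
            simp only [mul_assoc]
        _ = (tGp x)⁻¹ * Gp x := by rw [Matrix.inv_mul_of_isUnit h3, one_mul]
    refine ⟨exists_isScalarBoundedCanonicalFactorization hAm hAp hA, fun dm dp hd => ?_⟩
    have hDm := matInvertibleHInf_diagonal fun j => (hd j).1
    have hDp := matInvertibleHInf_diagonal fun j => (hd j).2.1
    have hrecover : ∀ {T H E Z : Matrix (Fin n) (Fin n) ℂ}, IsUnit T → IsUnit E →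
        T⁻¹ * H * E = Z → H = T * Z * E⁻¹ := fun {T H E Z} hT hE hZ => by
      rw [← hZ, mul_assoc T, mul_assoc (T⁻¹ * H), Matrix.mul_inv_of_isUnit hE, mul_one,
        ← mul_assoc, Matrix.mul_inv_of_isUnit hT, one_mul]
    -- Here D₋ = DD₊, so A₋D₋ = A₋DD₊ = A₊D₊; one matrix `Z` thus serves both signs.
    obtain ⟨Z, hZ, hZm, hZp⟩ := exists_isUnit_ae_eq_const (hAm.mul hDm) (hAp.mul hDp) (by
      filter_upwards [hA, hdiag d dm dp hd] with x h1 h2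
      rw [← h1, ← h2, mul_assoc ((tGm x)⁻¹ * Gm x)])
    refine ⟨Z, hZ, ?_, ?_⟩
    · filter_upwards [htm.1, hDm.1, hZm] with x h1 h2 h3
      exact hrecover h1 h2 h3
    · filter_upwards [htp.1, hDp.1, hZp] with x h1 h2 h3
      exact hrecover h1 h2 h3
  · have hDm := matInvertibleHInf_diagonal fun j => (hd j).1
    have hDp := matInvertibleHInf_diagonal fun j => (hd j).2.1
    refine ⟨(htm.mul (matInvertibleHInf_const _ hZ)).mul hDm.inv,
      (htp.mul (matInvertibleHInf_const _ hZ)).mul hDp.inv, ?_⟩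
    filter_upwards [hGt, hdiag d dm dp hd, hDm.1, hDp.1] with x h1 h2 h3 h4
    rw [h1, Matrix.mul_inv_rev, Matrix.mul_inv_rev, Matrix.inv_inv_of_isUnit h4]
    calc tGm x * (tGp x)⁻¹ = tGm x * (Z * Z⁻¹) * (tGp x)⁻¹ := by
          rw [Matrix.mul_inv_of_isUnit hZ, mul_one]
      _ = tGm x * Z * ((Matrix.diagonal fun j => dm j x)⁻¹ * Matrix.diagonal fun j => dm j x) *
            (Z⁻¹ * (tGp x)⁻¹) := by
          rw [Matrix.inv_mul_of_isUnit h3, mul_one]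
          simp only [mul_assoc]
      _ = _ := by
          -- Only the uninverted D₋ becomes DD₊; the inverted one belongs to the new left factor.
          nth_rewrite 2 [← h2]
          simp only [mul_assoc]
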